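/- Fix a finite nonempty set $AP$ of atomic propositions. LTL formulae are generated by $\varphi ::= \bot \mid p \mid \lnot\varphi \mid \varphi\lor\varphi \mid \mathsf{X}\varphi \mid \varphi\,\mathsf{U}\,\varphi$ with $p\in AP$; let $\mathrm{Fm}$ be the set of all of them, and let $\pi\models\varphi$ be the usual satisfaction relation between traces $\pi\in(2^{AP})^\omega$ and formulae. A Kripke structure $M$ has a finite set of states, a nonempty set of initial states, a left-total transition relation and a labelling of the states by subsets of $AP$; $M\models\varphi$ means that all traces of $M$ satisfy $\varphi$. For $X\subseteq \mathrm{Fm}$ let $\mathrm{Cn}(X)$ be the set of all formulae $\psi$ such that every Kripke structure satisfying all formulae in $X$ satisfies $\psi$. A theory is a set $K\subseteq \mathrm{Fm}$ with $\mathrm{Cn}(K)=K$; it is a complete consistent theory (CCT) if moreover $K\neq \mathrm{Fm}$ and, for every formula $\varphi$, $\varphi\in K$ or $\lnot\varphi\in K$. Let $UP$ be the set of ultimately periodic traces $\rho\,\sigma^\omega$ ($\rho,\sigma$ finite words, $\sigma$ nonempty), and put $CCT(\pi):=\{\varphi\in \mathrm{Fm} \mid \pi\models\varphi\}$. A Büchi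 automaton $A$ over $2^{AP}$ has a finite set of states, a set of initial states, a set of recurrence states, and a transition relation; its language $L(A)$ is the set of traces that have a run which starts in an initial state and visits recurrence states infinitely often. The support of $A$ is $S(A):=\{\varphi\in \mathrm{Fm}\mid \pi\models\varphi \text{ for all } \pi\in L(A)\}$. An encoding consists of a finite alphabet $\Sigma_C$ and a partial function from $\Sigma_C^*$ to the set of theories. Theorem. 1. For every $\pi\in UP$, the set $CCT(\pi)$ is a complete consistent theory. 2. For every Büchi automaton $A$ over $2^{AP}$, $$S(A)=\bigcap\{\,CCT(\pi)\mid \pi\in L(A)\cap UP\,\}$$ (the empty intersection being $\mathrm{Fm}$), and $S(A)$ is a theory. 3. Büchi automata define an encoding. Describe an automaton with states $0,\dots,n-1$ by a finite word over the finite alphabet consisting of a tick, the letters in $2^{AP}$ and three keywords: first $n$ ticks, then a list of declarations of its initial states, of its recurrence states and of its transitions, with states written in unary. There is an encoding whose partial function is defined exactly on the words that describe some automaton and maps each word describing an automaton $A$ to the theory $S(A)$. Every Büchi automaton $A$ over $2^{AP}$ is, up to renaming its states, described by some word, and this word is mapped to $S(A)$. -/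

import Mathlib

/-! ### Theories and encodings of a logic, given by its consequence operator -/

/-- `K` is a theory of the logic with consequence operator `Cn` if `Cn K = K`. -/
def IsTheory {F : Type*} (Cn : Set F → Set F) (K : Set F) : Prop :=
  Cn K = K

/-- The set of all theories of the logic with consequence operator `Cn`. -/
def Theories {F : Type*} (Cn : Set F → Set F) : Type _ :=
  {K : Set F // IsTheory Cn K}

/-- An encoding with code alphabet `C`: the alphabet is finite and there is a partial function
from the finite words over `C` to the theories of the logic. -/
structure Encoding {F : Type*} (Cn : Set F → Set F) (C : Type*) where
  finite_alphabet : Finite C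
  toFun : List C →. Theories Cn

/-! ### Infinite words -/

/-- The infinite repetition `σ^ω` of a nonempty finite word `σ`. -/
def omegaPower {α : Type*} (σ : List α) (hσ : σ ≠ []) : ℕ → α :=
  fun i => σ[i % σ.length]'(Nat.mod_lt _ (List.length_pos_of_ne_nil hσ))

/-- The infinite word `ρ w`: the finite word `ρ` followed by the infinite word `w`. -/
def prependWord {α : Type*} (ρ : List α) (w : ℕ → α) : ℕ → α :=
  fun i => if h : i < ρ.length then ρ[i] else w (i - ρ.length)

/-- The suffix `w^i` of an infinite word starting at position `i`. -/
def wordSuffix {α : Type*} (w : ℕ → α) (i : ℕ) : ℕ → α :=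
  fun k => w (i + k)

/-- The set `UP` of ultimately periodic infinite words, i.e. words `ρ σ^ω`. -/
def ultimatelyPeriodic (α : Type*) : Set (ℕ → α) :=
  {w | ∃ (ρ σ : List α) (hσ : σ ≠ []), w = prependWord ρ (omegaPower σ hσ)}

/-! ### Linear temporal logic -/

namespace LTL

/-- LTL formulae over the atomic propositions `AP`. -/
inductive Formula (AP : Type*) where
  | bot : Formula AP
  | atom : AP → Formula AP
  | neg : Formula AP → Formula AP
  | disj : Formula AP → Formula AP → Formula AP
  | next : Formula AP → Formula AP
  | untl : Formula AP → Formula AP → Formula AP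

/-- Traces: infinite sequences of sets of atomic propositions. -/
abbrev Trace (AP : Type*) := ℕ → Set AP

/-- Satisfaction of an LTL formula by a trace. -/
def Sat {AP : Type*} : Trace AP → Formula AP → Prop
  | _, .bot => False
  | π, .atom p => p ∈ π 0
  | π, .neg φ => ¬ Sat π φ
  | π, .disj φ ψ => Sat π φ ∨ Sat π ψ
  | π, .next φ => Sat (wordSuffix π 1) φ
  | π, .untl φ ψ => ∃ i, Sat (wordSuffix π i) ψ ∧ ∀ j < i, Sat (wordSuffix π j) φ

/-- Kripke structures: finitely many states, a nonempty set of initial states, a left-total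
transition relation and a labelling. (Every finite set of states has a copy in `Type`.) -/
structure Kripke (AP : Type*) where
  State : Type
  finite_state : Finite State
  init : Set State
  init_nonempty : init.Nonempty
  trans : Set (State × State)
  trans_total : ∀ s, ∃ s', (s, s') ∈ trans
  label : State → Set AP

/-- The traces of a Kripke structure. -/
def Kripke.traces {AP : Type*} (M : Kripke AP) : Set (Trace AP) :=
  {π | ∃ s : ℕ → M.State, s 0 ∈ M.init ∧ (∀ i, (s i, s (i + 1)) ∈ M.trans) ∧
    ∀ i, π i = M.label (s i)}

/-- `M ⊨ φ`: all traces of `M` satisfy `φ`. -/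
def Kripke.Models {AP : Type*} (M : Kripke AP) (φ : Formula AP) : Prop :=
  ∀ π ∈ M.traces, Sat π φ

/-- The consequence operator of LTL. -/
def Cn {AP : Type*} (X : Set (Formula AP)) : Set (Formula AP) :=
  {ψ | ∀ M : Kripke AP, (∀ φ ∈ X, M.Models φ) → M.Models ψ}

/-- Complete consistent theories (CCTs) of LTL. -/
def IsCCT {AP : Type*} (K : Set (Formula AP)) : Prop :=
  IsTheory Cn K ∧ K ≠ Set.univ ∧ ∀ φ : Formula AP, φ ∈ K ∨ φ.neg ∈ K

/-- `CCT(π)`: the set of formulae satisfied by the trace `π`. -/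
def traceCCT {AP : Type*} (π : Trace AP) : Set (Formula AP) :=
  {φ | Sat π φ}

end LTL

/-! ### Büchi automata -/

/-- Büchi automata with the finite set of states `Q` and the finite nonempty alphabet `α`. -/
structure BuchiAutomaton (Q α : Type*) [Finite Q] [Finite α] [Nonempty α] where
  trans : Set (Q × α × Q)
  init : Set Q
  recur : Set Q

namespace BuchiAutomaton

variable {Q Q' α : Type*} [Finite Q] [Finite Q'] [Finite α] [Nonempty α]

/-- The language of a Büchi automaton: the infinite words with a run that starts in an initial
state and visits recurrence states infinitely often. -/
def language (A : BuchiAutomaton Q α) : Set (ℕ → α) :=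
  {w | ∃ q : ℕ → Q, q 0 ∈ A.init ∧ (∀ i, (q i, w i, q (i + 1)) ∈ A.trans) ∧
    {i | q i ∈ A.recur}.Infinite}

/-- The isomorphic copy of an automaton obtained by renaming its states along `e`. -/
def rename (A : BuchiAutomaton Q α) (e : Q ≃ Q') : BuchiAutomaton Q' α where
  trans := {t | (e.symm t.1, t.2.1, e.symm t.2.2) ∈ A.trans}
  init := {q | e.symm q ∈ A.init}
  recur := {q | e.symm q ∈ A.recur}

/-- The support of a Büchi automaton over the alphabet `𝒫(AP)`: all LTL formulae that are
satisfied by all accepted traces. -/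
def support {AP : Type*} [Finite AP] (A : BuchiAutomaton Q (Set AP)) : Set (LTL.Formula AP) :=
  {φ | ∀ π ∈ A.language, LTL.Sat π φ}

end BuchiAutomaton

/-! ### Code words for Büchi automata

An automaton with states `0, …, n - 1` is described by the word consisting of `n` ticks, followed
by a list of declarations, in any order, of its initial states, recurrence states and transitions.
States are written in unary. -/

/-- The code alphabet: a tick, the letters of the automaton alphabet and three keywords. -/
inductive CodeSymbol (α : Type*) where
  | tick : CodeSymbol α
  | letter : α → CodeSymbol α
  | kwInit : CodeSymbol α
  | kwRecur : CodeSymbol α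
  | kwTrans : CodeSymbol α

/-- Declarations about an automaton with states `0, …, n - 1`. -/
inductive Declaration (n : ℕ) (α : Type*) where
  | init : Fin n → Declaration n α
  | recur : Fin n → Declaration n α
  | trans : Fin n → α → Fin n → Declaration n α

/-- The number `k` written in unary. -/
def unaryCode (α : Type*) (k : ℕ) : List (CodeSymbol α) :=
  List.replicate k .tick

/-- The finite word by which a declaration is written. -/
def Declaration.code {n : ℕ} {α : Type*} : Declaration n α → List (CodeSymbol α)
  | .init i => .kwInit :: unaryCode α i
  | .recur i => .kwRecur :: unaryCode α i
  | .trans i a j => .kwTrans :: (unaryCode α i ++ .letter a :: unaryCode α j)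

/-- The automaton given by a list of declarations: exactly the declared states are initial,
resp. recurrent, and exactly the declared transitions exist. -/
def automatonOf {n : ℕ} {α : Type*} [Finite α] [Nonempty α] (ds : List (Declaration n α)) :
    BuchiAutomaton (Fin n) α where
  trans := {t | .trans t.1 t.2.1 t.2.2 ∈ ds}
  init := {i | .init i ∈ ds}
  recur := {i | .recur i ∈ ds}

/-- The word `w` is a code word of the automaton `A`. -/
def IsCodeOf {n : ℕ} {α : Type*} [Finite α] [Nonempty α] (w : List (CodeSymbol α))
    (A : BuchiAutomaton (Fin n) α) : Prop :=
  ∃ ds : List (Declaration n α), w = unaryCode α n ++ ds.flatMap Declaration.code ∧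
    A = automatonOf ds

/-! A lasso is a finite graph with a single run, so an ultimately periodic trace is the only trace
of some Kripke structure. That structure satisfies exactly `traceCCT π`, which is therefore closed
under `Cn`; intersections of such sets are theories by monotonicity of `Cn`.

The support formula says that an accepted trace satisfying a formula (apply this to the negation of
a formula outside the support) can be made ultimately periodic. By pigeonhole, the automaton state
and the truth values of all subformulae recur together along the run. Cutting at two such positions,
far enough apart to enclose a recurrence state and the fulfilments of the pending untils, gives a
lasso that is still accepted (`comp_lassoIndex_mem_language`) and satisfies the same subformulae
(`sat_comp_lassoIndex_iff`).

The encoding is well defined because code words parse uniquely (`IsCodeOf.unique`). -/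

/-! ### Folding an infinite word into a lasso -/

/-- The position reached after `k` steps on the lasso with stem `0, …, i - 1` and loop
`i, …, i + p - 1`. -/
def lassoIndex (i p k : ℕ) : ℕ :=
  if k < i then k else i + (k - i) % p

lemma lassoIndex_zero {i p : ℕ} : lassoIndex i p 0 = 0 := by
  unfold lassoIndex
  split_ifs with h
  · rfl
  · have : i = 0 := by omega
    simp [this]

lemma lassoIndex_lt {i p : ℕ} (hp : 0 < p) (k : ℕ) : lassoIndex i p k < i + p := by
  unfold lassoIndex
  have := Nat.mod_lt (k - i) hp
  split_ifs <;> omega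

/-- Every loop position is met once per pass, hence infinitely often. -/
lemma lassoIndex_add {i p m : ℕ} (hm : m < p) (n : ℕ) :
    lassoIndex i p (i + (n * p + m)) = i + m := by
  unfold lassoIndex
  rw [if_neg (by omega), Nat.add_sub_cancel_left, mul_comm, Nat.mul_add_mod, Nat.mod_eq_of_lt hm]

lemma lassoIndex_succ {i p : ℕ} (hp : 0 < p) (k : ℕ) :
    lassoIndex i p (k + 1) = lassoIndex i p k + 1 ∨
      lassoIndex i p k + 1 = i + p ∧ lassoIndex i p (k + 1) = i := by
  unfold lassoIndex
  rcases lt_trichotomy (k + 1) i with h | h | h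
  · left; rw [if_pos h, if_pos (by omega)]
  · left; subst h; simp
  · rw [if_neg (by omega), if_neg (by omega), show k + 1 - i = k - i + 1 by omega]
    have hlt := Nat.mod_lt (k - i) hp
    have hadd := Nat.mod_add_mod (k - i) p 1
    rcases Nat.lt_or_ge ((k - i) % p + 1) p with h1 | h1
    · rw [Nat.mod_eq_of_lt h1] at hadd
      omega
    · have h2 : (k - i) % p + 1 = p := by omega
      rw [h2, Nat.mod_self] at hadd
      omega

/-- A property of positions which agrees at both ends of the loop is transported along the
successor on the lasso. -/
lemma apply_lassoIndex_succ {β : Sort*} {i p : ℕ} (hp : 0 < p) (g : ℕ → β) (hg : g i = g (i + p))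
    (k : ℕ) : g (lassoIndex i p (k + 1)) = g (lassoIndex i p k + 1) := by
  rcases lassoIndex_succ hp k with h | ⟨h, h'⟩
  · rw [h]
  · rw [h, h', hg]

lemma comp_lassoIndex_mem_ultimatelyPeriodic {α : Type*} (w : ℕ → α) {i p : ℕ} (hp : 0 < p) :
    w ∘ lassoIndex i p ∈ ultimatelyPeriodic α := by
  refine ⟨List.ofFn fun k : Fin i => w k, List.ofFn fun k : Fin p => w (i + k), ?_, ?_⟩
  · simpa [List.ofFn_eq_nil_iff] using hp.ne'
  · funext k
    by_cases h : k < i <;> simp [prependWord, omegaPower, lassoIndex, h]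

lemma eq_comp_lassoIndex_of_mem_ultimatelyPeriodic {α : Type*} {w : ℕ → α}
    (hw : w ∈ ultimatelyPeriodic α) : ∃ i p, 0 < p ∧ w = w ∘ lassoIndex i p := by
  obtain ⟨ρ, σ, hσ, rfl⟩ := hw
  refine ⟨ρ.length, σ.length, List.length_pos_of_ne_nil hσ, ?_⟩
  funext k
  by_cases h : k < ρ.length <;> simp [prependWord, omegaPower, lassoIndex, h]

namespace LTL

variable {AP : Type*}

/-! ### Complete consistent theories of ultimately periodic traces -/

lemma subset_Cn (X : Set (Formula AP)) : X ⊆ Cn X :=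
  fun _ hφ _ hM => hM _ hφ

lemma Cn_mono {X Y : Set (Formula AP)} (h : X ⊆ Y) : Cn X ⊆ Cn Y :=
  fun _ hψ M hM => hψ M fun φ hφ => hM φ (h hφ)

/-- The Kripke structure that walks along a lasso in the trace `π`. -/
def lassoKripke (π : Trace AP) (i p : ℕ) (hp : 0 < p) : Kripke AP where
  State := Fin (i + p)
  finite_state := inferInstance
  init := {⟨lassoIndex i p 0, lassoIndex_lt hp 0⟩}
  init_nonempty := Set.singleton_nonempty _
  trans := {t | t.2.1 = if t.1.1 + 1 = i + p then i else t.1.1 + 1}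
  trans_total := fun s => by
    refine ⟨⟨if s.1 + 1 = i + p then i else s.1 + 1, ?_⟩, rfl⟩
    have := s.2
    split_ifs <;> omega
  label := fun s => π s

lemma lassoIndex_succ_eq_ite {i p : ℕ} (hp : 0 < p) (k : ℕ) :
    lassoIndex i p (k + 1) =
      if lassoIndex i p k + 1 = i + p then i else lassoIndex i p k + 1 := by
  have := lassoIndex_lt (i := i) hp (k + 1)
  rcases lassoIndex_succ (i := i) hp k with h | h <;> split_ifs <;> omega

/-- One initial state and deterministic transitions leave exactly one run. -/
lemma traces_lassoKripke (π : Trace AP) (i p : ℕ) (hp : 0 < p) :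
    (lassoKripke π i p hp).traces = {π ∘ lassoIndex i p} := by
  ext τ
  simp only [Kripke.traces, Set.mem_ofPred_eq, Set.mem_singleton_iff]
  constructor
  · rintro ⟨s, h0, hs, hτ⟩
    have key : ∀ k, (s k : Fin (i + p)).1 = lassoIndex i p k := by
      intro k
      induction k with
      | zero => exact congrArg Fin.val (show s 0 = (⟨_, lassoIndex_lt hp 0⟩ : Fin (i + p)) from h0)
      | succ k ih =>
        rw [lassoIndex_succ_eq_ite hp, ← ih]
        exact hs k
    funext k
    rw [hτ k, Function.comp_apply, ← key k]
    rfl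
  · rintro rfl
    exact ⟨fun k => ⟨lassoIndex i p k, lassoIndex_lt hp k⟩, rfl,
      fun k => lassoIndex_succ_eq_ite hp k, fun _ => rfl⟩

lemma exists_kripke_traces_eq_singleton {π : Trace AP} (hπ : π ∈ ultimatelyPeriodic (Set AP)) :
    ∃ M : Kripke AP, M.traces = {π} := by
  obtain ⟨i, p, hp, h⟩ := eq_comp_lassoIndex_of_mem_ultimatelyPeriodic hπ
  exact ⟨lassoKripke π i p hp, by rw [traces_lassoKripke, ← h]⟩

lemma isTheory_traceCCT {π : Trace AP} (hπ : π ∈ ultimatelyPeriodic (Set AP)) :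
    IsTheory Cn (traceCCT π) := by
  obtain ⟨M, hM⟩ := exists_kripke_traces_eq_singleton hπ
  have hMφ : ∀ φ, M.Models φ ↔ Sat π φ := fun φ => by simp [Kripke.Models, hM]
  exact Set.Subset.antisymm (fun ψ hψ => (hMφ ψ).1 (hψ M fun φ hφ => (hMφ φ).2 hφ)) (subset_Cn _)

lemma isCCT_traceCCT {π : Trace AP} (hπ : π ∈ ultimatelyPeriodic (Set AP)) :
    IsCCT (traceCCT π) := by
  refine ⟨isTheory_traceCCT hπ, fun h => ?_, fun φ => ?_⟩
  · exact ((Set.ext_iff.1 h .bot).2 trivial : Sat π .bot)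
  · simpa [traceCCT, Sat] using em (Sat π φ)

lemma isTheory_biInter_traceCCT {S : Set (Trace AP)} (hS : S ⊆ ultimatelyPeriodic (Set AP)) :
    IsTheory Cn (⋂ π ∈ S, traceCCT π) := by
  refine Set.Subset.antisymm (Set.subset_iInter₂ fun π hπ => ?_) (subset_Cn _)
  calc Cn (⋂ π ∈ S, traceCCT π) ⊆ Cn (traceCCT π) := Cn_mono (Set.biInter_subset_of_mem hπ)
    _ = traceCCT π := isTheory_traceCCT (hS hπ)

/-! ### Folding preserves satisfaction -/

/-- The subformulae of a formula. -/
def Formula.sub : Formula AP → Set (Formula AP)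
  | .bot => {.bot}
  | .atom p => {.atom p}
  | .neg φ => insert (.neg φ) φ.sub
  | .disj φ ψ => insert (.disj φ ψ) (φ.sub ∪ ψ.sub)
  | .next φ => insert (.next φ) φ.sub
  | .untl φ ψ => insert (.untl φ ψ) (φ.sub ∪ ψ.sub)

lemma Formula.finite_sub (φ : Formula AP) : φ.sub.Finite := by
  induction φ with
  | bot => exact Set.finite_singleton _
  | atom p => exact Set.finite_singleton _
  | neg φ h => exact h.insert _
  | disj φ ψ h h' => exact (h.union h').insert _
  | next φ h => exact h.insert _
  | untl φ ψ h h' => exact (h.union h').insert _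

lemma wordSuffix_wordSuffix {α : Type*} (w : ℕ → α) (i j : ℕ) :
    wordSuffix (wordSuffix w i) j = wordSuffix w (i + j) := by
  funext k
  simp [wordSuffix, add_assoc]

lemma sat_untl_iff (π : Trace AP) (φ ψ : Formula AP) (k : ℕ) :
    Sat (wordSuffix π k) (.untl φ ψ) ↔
      ∃ m, Sat (wordSuffix π (k + m)) ψ ∧ ∀ l < m, Sat (wordSuffix π (k + l)) φ := by
  simp [Sat, wordSuffix_wordSuffix]

lemma sat_untl_succ_iff (π : Trace AP) (φ ψ : Formula AP) (k : ℕ) :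
    Sat (wordSuffix π k) (.untl φ ψ) ↔ Sat (wordSuffix π k) ψ ∨
      Sat (wordSuffix π k) φ ∧ Sat (wordSuffix π (k + 1)) (.untl φ ψ) := by
  simp only [sat_untl_iff]
  constructor
  · rintro ⟨_ | m, hm, h⟩
    · exact Or.inl hm
    · refine Or.inr ⟨h 0 m.succ_pos, m, ?_, fun l hl => ?_⟩
      · rwa [add_assoc, add_comm 1]
      · rw [add_assoc, add_comm 1]
        exact h (l + 1) (by omega)
  · rintro (h | ⟨h, m, hm, h'⟩)
    · exact ⟨0, h, by simp⟩
    · refine ⟨m + 1, by rwa [add_comm m, ← add_assoc], fun l hl => ?_⟩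
      cases l with
      | zero => exact h
      | succ l =>
        rw [add_comm l, ← add_assoc]
        exact h' l (by omega)

/-- If the formulae of `S` have the same truth values at both ends of the loop, and the until
formulae of `S` that hold at its start are fulfilled within the loop, then folding a trace
into the lasso preserves satisfaction of every formula with all subformulae in `S`. -/
lemma sat_comp_lassoIndex_iff (π : Trace AP) {i p : ℕ} (hp : 0 < p) {S : Set (Formula AP)}
    (hS : ∀ φ ∈ S, (Sat (wordSuffix π i) φ ↔ Sat (wordSuffix π (i + p)) φ))
    (hU : ∀ φ ψ, .untl φ ψ ∈ S → Sat (wordSuffix π i) (.untl φ ψ) →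
      ∃ m < p, Sat (wordSuffix π (i + m)) ψ)
    (φ : Formula AP) (hφ : φ.sub ⊆ S) (k : ℕ) :
    Sat (wordSuffix (π ∘ lassoIndex i p) k) φ ↔
      Sat (wordSuffix π (lassoIndex i p k)) φ := by
  -- Formulae in `S` cannot tell the jump back to `i` from moving on to `i + p`.
  have step : ∀ φ ∈ S, ∀ k, Sat (wordSuffix π (lassoIndex i p (k + 1))) φ ↔
      Sat (wordSuffix π (lassoIndex i p k + 1)) φ := fun φ hφ k =>
    (apply_lassoIndex_succ hp (fun k => Sat (wordSuffix π k) φ) (propext (hS φ hφ)) k).to_iff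
  induction φ generalizing k with
  | bot => rfl
  | atom a => simp [Sat, wordSuffix]
  | neg φ ih =>
    simp only [Sat, ih ((Set.subset_insert _ _).trans hφ)]
  | disj φ ψ ih ih' =>
    have h := (Set.subset_insert _ _).trans hφ
    simp only [Sat, ih (Set.subset_union_left.trans h), ih' (Set.subset_union_right.trans h)]
  | next φ ih =>
    have h := (Set.subset_insert _ _).trans hφ
    have hmem : φ ∈ S := h (by cases φ <;> simp [Formula.sub])
    simp only [Sat, wordSuffix_wordSuffix, ih h, step φ hmem]
  | untl φ ψ ih ih' =>
    have h := (Set.subset_insert _ _).trans hφ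
    have hmem : Formula.untl φ ψ ∈ S := hφ (Set.mem_insert _ _)
    simp only [sat_untl_iff _ _ _ k, ih (Set.subset_union_left.trans h),
      ih' (Set.subset_union_right.trans h)]
    -- By `step`, the expansion law of until holds along the lasso too.
    have expand : ∀ k, Sat (wordSuffix π (lassoIndex i p k)) (.untl φ ψ) ↔
        Sat (wordSuffix π (lassoIndex i p k)) ψ ∨ Sat (wordSuffix π (lassoIndex i p k)) φ ∧
          Sat (wordSuffix π (lassoIndex i p (k + 1))) (.untl φ ψ) := fun k => by
      rw [sat_untl_succ_iff, step _ hmem]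
    constructor
    · rintro ⟨m, hm, hlt⟩
      induction m generalizing k with
      | zero => exact (expand k).2 (Or.inl hm)
      | succ m ihm =>
        refine (expand k).2 (Or.inr ⟨hlt 0 m.succ_pos, ihm (k + 1) ?_ fun l hl => ?_⟩)
        · rwa [add_assoc, add_comm 1]
        · rw [add_assoc, add_comm 1]
          exact hlt (l + 1) (by omega)
    · intro hk
      -- While `ψ` is delayed, the until stays pending and `φ` holds.
      have unfold_until : ∀ m, (∀ l < m, ¬ Sat (wordSuffix π (lassoIndex i p (k + l))) ψ) →
          Sat (wordSuffix π (lassoIndex i p (k + m))) (.untl φ ψ) ∧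
            ∀ l < m, Sat (wordSuffix π (lassoIndex i p (k + l))) φ := by
        intro m
        induction m with
        | zero => exact fun _ => ⟨hk, by simp⟩
        | succ m ihm =>
          intro hm
          obtain ⟨h1, h2⟩ := ihm fun l hl => hm l (by omega)
          obtain ⟨h3, h4⟩ := ((expand (k + m)).1 h1).resolve_left (hm m (by omega))
          refine ⟨h4, fun l hl => ?_⟩
          rcases Nat.lt_succ_iff_lt_or_eq.1 hl with hl | rfl
          exacts [h2 l hl, h3]
      -- Otherwise the until is still pending at time `i + k * p`, which is not before `k` and is a
      -- start of the loop; `hU` then fulfils it within that pass.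
      have ex : ∃ m, Sat (wordSuffix π (lassoIndex i p (k + m))) ψ := by
        by_contra! hne
        have hk' : k ≤ i + k * p := by nlinarith
        have h1 := (unfold_until (i + k * p - k) fun l _ => hne l).1
        rw [Nat.add_sub_cancel' hk'] at h1
        have h0 : lassoIndex i p (i + k * p) = i := by simpa using lassoIndex_add hp k
        rw [h0] at h1
        obtain ⟨m, hm, h2⟩ := hU φ ψ hmem h1
        refine hne (i + (k * p + m) - k) ?_
        rwa [Nat.add_sub_cancel' (by omega), lassoIndex_add hm]
      classical
      exact ⟨Nat.find ex, Nat.find_spec ex,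
        (unfold_until _ fun l hl => Nat.find_min ex hl).2⟩

end LTL

namespace BuchiAutomaton

/-! ### The support of a Büchi automaton -/

/-- The run is folded together with the word; a recurrence state on the loop is revisited in every
pass. -/
lemma comp_lassoIndex_mem_language {Q α : Type*} [Finite Q] [Finite α] [Nonempty α]
    (A : BuchiAutomaton Q α) {w : ℕ → α} {q : ℕ → Q} (h0 : q 0 ∈ A.init)
    (hq : ∀ k, (q k, w k, q (k + 1)) ∈ A.trans) {i p m : ℕ} (hloop : q i = q (i + p))
    (hm : m < p) (hrec : q (i + m) ∈ A.recur) : w ∘ lassoIndex i p ∈ A.language := by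
  have hp : 0 < p := by omega
  refine ⟨q ∘ lassoIndex i p, ?_, fun k => ?_, ?_⟩
  · rwa [Function.comp_apply, lassoIndex_zero]
  · simp only [Function.comp_apply, apply_lassoIndex_succ hp q hloop]
    exact hq _
  · refine Set.infinite_of_injective_forall_mem (f := fun n => i + (n * p + m)) ?_ fun n => ?_
    · intro a b hab
      exact Nat.eq_of_mul_eq_mul_right hp (by simpa using hab)
    · simpa [lassoIndex_add hm] using hrec

variable {AP Q Q' : Type*} [Finite AP] [Finite Q] [Finite Q']

/-- Every formula that is satisfied by some accepted trace is satisfied by some accepted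
ultimately periodic trace. -/
lemma exists_ultimatelyPeriodic_sat (A : BuchiAutomaton Q (Set AP)) {π : LTL.Trace AP}
    (hπ : π ∈ A.language) {φ : LTL.Formula AP} (hφ : LTL.Sat π φ) :
    ∃ τ ∈ A.language ∩ ultimatelyPeriodic (Set AP), LTL.Sat τ φ := by
  obtain ⟨q, h0, hq, hrec⟩ := hπ
  have := φ.finite_sub.to_subtype
  let g : ℕ → Q × (φ.sub → Prop) := fun k => (q k, fun ψ => LTL.Sat (wordSuffix π k) ψ)
  obtain ⟨c, hc⟩ := Finite.exists_infinite_fiber g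
  rw [Set.infinite_coe_iff] at hc
  obtain ⟨i, hi : g i = c⟩ := hc.nonempty
  obtain ⟨r, hr, hir⟩ := hrec.exists_gt i
  -- There are finitely many until subformulae, so one bound `N` serves for all those true at `i`.
  have hev : ∀ᶠ N in Filter.atTop, ∀ χ : φ.sub, ∀ ψ₁ ψ₂, χ.1 = .untl ψ₁ ψ₂ →
      LTL.Sat (wordSuffix π i) (.untl ψ₁ ψ₂) →
      ∃ m < N, LTL.Sat (wordSuffix π (i + m)) ψ₂ := by
    refine Filter.eventually_all.2 fun χ => ?_
    by_cases h : ∃ m ψ₁ ψ₂, χ.1 = .untl ψ₁ ψ₂ ∧ LTL.Sat (wordSuffix π (i + m)) ψ₂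
    · obtain ⟨m, ψ₁, ψ₂, hχ, hm⟩ := h
      filter_upwards [Filter.eventually_gt_atTop m] with N hN ψ₁' ψ₂' hχ' _
      rw [hχ] at hχ'
      cases hχ'
      exact ⟨m, hN, hm⟩
    · refine Filter.Eventually.of_forall fun N ψ₁ ψ₂ hχ hs => ?_
      obtain ⟨m, hm, -⟩ := (LTL.sat_untl_iff _ _ _ _).1 hs
      exact (h ⟨m, ψ₁, ψ₂, hχ, hm⟩).elim
  -- The loop must end beyond both the recurrence visit `r` and the until fulfilments, which lie
  -- before `i + N`.
  obtain ⟨N, hN⟩ := hev.exists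
  obtain ⟨j, hj : g j = c, hij⟩ := hc.exists_gt (max r (i + N))
  obtain ⟨p, rfl⟩ : ∃ p, j = i + p := ⟨j - i, by omega⟩
  have hp : 0 < p := by omega
  have hij' : g i = g (i + p) := hi.trans hj.symm
  refine ⟨π ∘ lassoIndex i p, ⟨?_, comp_lassoIndex_mem_ultimatelyPeriodic π hp⟩, ?_⟩
  · refine A.comp_lassoIndex_mem_language h0 hq (congrArg Prod.fst hij') (m := r - i)
      (by omega) ?_
    rwa [Nat.add_sub_cancel' hir.le]
  · have key := LTL.sat_comp_lassoIndex_iff π hp (S := φ.sub)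
      (fun ψ hψ => (congrFun (congrArg Prod.snd hij') ⟨ψ, hψ⟩).to_iff)
      (fun ψ₁ ψ₂ hmem hs => by
        obtain ⟨m, hm, h⟩ := hN ⟨_, hmem⟩ ψ₁ ψ₂ rfl hs
        exact ⟨m, by omega, h⟩) φ subset_rfl 0
    have hz : ∀ w : LTL.Trace AP, wordSuffix w 0 = w := fun w => by
      funext k
      simp [wordSuffix]
    rw [lassoIndex_zero, hz, hz] at key
    exact key.2 hφ

lemma support_eq_biInter (A : BuchiAutomaton Q (Set AP)) :
    A.support = ⋂ π ∈ A.language ∩ ultimatelyPeriodic (Set AP), LTL.traceCCT π := by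
  refine Set.Subset.antisymm (Set.subset_iInter₂ fun π hπ φ hφ => hφ π hπ.1) fun φ hφ π hπ => ?_
  by_contra hn
  obtain ⟨τ, hτ, hs⟩ := A.exists_ultimatelyPeriodic_sat hπ (φ := φ.neg) hn
  exact hs (Set.mem_iInter₂.1 hφ τ hτ)

lemma isTheory_support (A : BuchiAutomaton Q (Set AP)) : IsTheory LTL.Cn A.support := by
  rw [support_eq_biInter]
  exact LTL.isTheory_biInter_traceCCT Set.inter_subset_right

lemma language_rename {α : Type*} [Finite α] [Nonempty α] (A : BuchiAutomaton Q α)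
    (e : Q ≃ Q') : (A.rename e).language = A.language := by
  ext w
  constructor
  · rintro ⟨q, h0, hq, hrec⟩
    exact ⟨e.symm ∘ q, h0, hq, hrec⟩
  · rintro ⟨q, h0, hq, hrec⟩
    exact ⟨e ∘ q, by simpa [rename] using h0, by simpa [rename] using hq,
      by simpa [rename] using hrec⟩

lemma support_rename (A : BuchiAutomaton Q (Set AP)) (e : Q ≃ Q') :
    (A.rename e).support = A.support := by
  simp only [support, language_rename]

end BuchiAutomaton

/-! ### Code words -/

section Code

variable {α : Type*}

instance [Finite α] : Finite (CodeSymbol α) :=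
  Finite.of_surjective
    (fun x : Fin 4 ⊕ α => Sum.elim ![.tick, .kwInit, .kwRecur, .kwTrans] CodeSymbol.letter x) (by
      rintro (_ | a | _ | _ | _)
      exacts [⟨.inl 0, rfl⟩, ⟨.inr a, rfl⟩, ⟨.inl 1, rfl⟩, ⟨.inl 2, rfl⟩, ⟨.inl 3, rfl⟩])

instance (n : ℕ) [Finite α] : Finite (Declaration n α) :=
  Finite.of_surjective
    (fun x : Fin n ⊕ Fin n ⊕ Fin n × α × Fin n =>
      Sum.elim Declaration.init
        (Sum.elim Declaration.recur fun t => Declaration.trans t.1 t.2.1 t.2.2) x) (by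
      rintro (i | i | ⟨i, a, j⟩)
      exacts [⟨.inl i, rfl⟩, ⟨.inr (.inl i), rfl⟩, ⟨.inr (.inr (i, a, j)), rfl⟩])

/-- The first symbol other than a tick, or the end of the word, marks where the number stops. -/
lemma unaryCode_append_inj {k k' : ℕ} {x x' : List (CodeSymbol α)}
    (hx : x.head? ≠ some .tick) (hx' : x'.head? ≠ some .tick)
    (h : unaryCode α k ++ x = unaryCode α k' ++ x') : k = k' ∧ x = x' := by
  induction k generalizing k' with
  | zero =>
    cases k' with
    | zero => exact ⟨rfl, h⟩
    | succ k' => exact (hx (by simp_all [unaryCode, List.replicate_succ])).elim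
  | succ k ih =>
    cases k' with
    | zero =>
      refine (hx' ?_).elim
      rw [show x' = unaryCode α 0 ++ x' from rfl, ← h]
      simp [unaryCode, List.replicate_succ]
    | succ k' =>
      have := ih (k' := k') (by simpa [unaryCode, List.replicate_succ] using h)
      exact ⟨congrArg _ this.1, this.2⟩

lemma head?_flatMap_code_ne_tick {n : ℕ} (ds : List (Declaration n α)) :
    (ds.flatMap Declaration.code).head? ≠ some .tick := by
  rcases ds with _ | ⟨_ | _ | _, ds⟩ <;> simp [Declaration.code]

lemma flatMap_code_injective {n : ℕ} :
    Function.Injective fun ds : List (Declaration n α) => ds.flatMap Declaration.code := by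
  intro ds
  induction ds with
  | nil => rintro (_ | ⟨_ | _ | _, ds'⟩) h <;> simp [Declaration.code] at h ⊢
  | cons d ds ih =>
    rintro (_ | ⟨d', ds'⟩) h
    · cases d <;> simp [Declaration.code] at h
    · have ht := head?_flatMap_code_ne_tick ds
      have ht' := head?_flatMap_code_ne_tick ds'
      cases d <;> cases d' <;>
        simp only [List.flatMap_cons, Declaration.code, List.cons_append, List.cons.injEq,
          reduceCtorEq, false_and, true_and, List.append_assoc] at h
      · obtain ⟨h1, h2⟩ := unaryCode_append_inj ht ht' h
        rw [Fin.ext h1, ih h2]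
      · obtain ⟨h1, h2⟩ := unaryCode_append_inj ht ht' h
        rw [Fin.ext h1, ih h2]
      · obtain ⟨h1, h2⟩ := unaryCode_append_inj (by simp) (by simp) h
        simp only [List.cons.injEq, CodeSymbol.letter.injEq] at h2
        obtain ⟨h3, h4⟩ := unaryCode_append_inj ht ht' h2.2
        rw [Fin.ext h1, h2.1, Fin.ext h3, ih h4]

variable [Finite α] [Nonempty α]

/-- A word is a code word of at most one automaton. -/
lemma IsCodeOf.unique {w : List (CodeSymbol α)} {n n' : ℕ} {A : BuchiAutomaton (Fin n) α}
    {A' : BuchiAutomaton (Fin n') α} (h : IsCodeOf w A) (h' : IsCodeOf w A') :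
    (⟨n, A⟩ : Σ n, BuchiAutomaton (Fin n) α) = ⟨n', A'⟩ := by
  obtain ⟨ds, rfl, rfl⟩ := h
  obtain ⟨ds', hw, rfl⟩ := h'
  -- The leading ticks determine the number of states; only then do both declaration lists have the
  -- same type.
  obtain ⟨rfl, h2⟩ := unaryCode_append_inj (head?_flatMap_code_ne_tick ds)
    (head?_flatMap_code_ne_tick ds') hw
  rw [flatMap_code_injective h2]

lemma exists_isCodeOf {n : ℕ} (A : BuchiAutomaton (Fin n) α) : ∃ w, IsCodeOf w A := by
  let holds : Declaration n α → Prop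
    | .init i => i ∈ A.init
    | .recur i => i ∈ A.recur
    | .trans i a j => (i, a, j) ∈ A.trans
  -- Only finitely many declarations exist, so the true ones can be listed, in any order.
  refine ⟨_, (Set.toFinite {d | holds d}).toFinset.toList, rfl, ?_⟩
  simp [automatonOf, holds]

end Code

/-- The encoding that maps the code words of Büchi automata to the supports of the automata. -/
noncomputable def buchiEncoding (AP : Type*) [Finite AP] :
    Encoding (LTL.Cn (AP := AP)) (CodeSymbol (Set AP)) where
  finite_alphabet := inferInstance
  toFun w :=
    ⟨∃ s : Σ n, BuchiAutomaton (Fin n) (Set AP), IsCodeOf w s.2,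
      fun h => ⟨h.choose.2.support, h.choose.2.isTheory_support⟩⟩

lemma mem_buchiEncoding_iff {AP : Type*} [Finite AP] (w : List (CodeSymbol (Set AP)))
    (K : Theories (LTL.Cn (AP := AP))) :
    K ∈ (buchiEncoding AP).toFun w ↔
      ∃ (n : ℕ) (A : BuchiAutomaton (Fin n) (Set AP)), IsCodeOf w A ∧ K.1 = A.support := by
  constructor
  · rintro ⟨h, rfl⟩
    exact ⟨_, h.choose.2, h.choose_spec, rfl⟩
  · rintro ⟨n, A, hw, hK⟩
    have h : ∃ s : Σ n, BuchiAutomaton (Fin n) (Set AP), IsCodeOf w s.2 := ⟨⟨n, A⟩, hw⟩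
    refine ⟨h, Subtype.ext ?_⟩
    rw [hK]
    -- The automaton picked by choice is the given one, by uniqueness.
    exact congrArg (fun s : Σ n, BuchiAutomaton (Fin n) (Set AP) => s.2.support)
      (h.choose_spec.unique hw)

theorem mainTheorem9 (AP : Type*) [Finite AP] [Nonempty AP] :
    -- `CCT(π)` is a complete consistent theory, for every ultimately periodic trace `π`
    (∀ π ∈ ultimatelyPeriodic (Set AP), LTL.IsCCT (LTL.traceCCT π)) ∧
    -- the support is a theory, and it is the intersection of the CCTs of the accepted
    -- ultimately periodic traces
    (∀ (Q : Type*) [Finite Q] (A : BuchiAutomaton Q (Set AP)),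
      IsTheory LTL.Cn A.support ∧
      A.support = ⋂ π ∈ A.language ∩ ultimatelyPeriodic (Set AP), LTL.traceCCT π) ∧
    -- mapping the code words of automata to the supports of these automata is an encoding,
    -- and every automaton has a code word, which is mapped to its support
    ∃ f : Encoding (LTL.Cn (AP := AP)) (CodeSymbol (Set AP)),
      (∀ (w : List (CodeSymbol (Set AP))) (K : Theories (LTL.Cn (AP := AP))),
        K ∈ f.toFun w ↔
          ∃ (n : ℕ) (A : BuchiAutomaton (Fin n) (Set AP)), IsCodeOf w A ∧ K.1 = A.support) ∧
      ∀ (Q : Type*) [Finite Q] (A : BuchiAutomaton Q (Set AP)),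
        ∃ (n : ℕ) (e : Q ≃ Fin n) (w : List (CodeSymbol (Set AP))),
          IsCodeOf w (A.rename e) ∧ ∃ K ∈ f.toFun w, K.1 = A.support := by
  refine ⟨fun π hπ => LTL.isCCT_traceCCT hπ,
    fun Q _ A => ⟨A.isTheory_support, A.support_eq_biInter⟩,
    buchiEncoding AP, mem_buchiEncoding_iff, fun Q _ A => ?_⟩
  let e := Finite.equivFin Q
  obtain ⟨w, hw⟩ := exists_isCodeOf (A.rename e)
  exact ⟨_, e, w, hw, ⟨A.support, A.isTheory_support⟩,
    (mem_buchiEncoding_iff w _).2 ⟨_, _, hw, (A.support_rename e).symm⟩, rfl⟩
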